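/- Let $d\ge 1$ be an integer and $q=2+4/d$. For $\psi\in L^2(\mathbb R^d)$ let $e^{it\Delta/2}\psi$ be the solution of the free Schrödinger equation with initial datum $\psi$ (the unitary group on $L^2(\mathbb R^d)$ defined through the Fourier transform), and write $\|\cdot\|$ for the norm of $L^2(\mathbb R^d)$. Define, with values in $[0,\infty]$, the Strichartz constant $$\mathcal S_d := (2\pi)^{-(d+2)/d}\sup_{0\ne\psi\in L^2(\mathbb R^d)}\frac{\iint_{\mathbb R\times\mathbb R^d}|e^{it\Delta/2}\psi(x)|^{q}\,dx\,dt}{\|\psi\|^{q}}$$ and the two-profile constant $$\tilde{\mathcal S}_d := (2\pi)^{-(d+2)/d}\sup_{(0,0)\ne(\psi^+,\psi^-)\in L^2(\mathbb R^d)^2}\frac{\lim_{\lambda\to\infty}\iint_{\mathbb R\times\mathbb R^d}\left|e^{it\Delta/2}\psi^+(x)+e^{i\lambda t}e^{-it\Delta/2}\psi^-(x)\right|^{q}\,dx\,dt}{\left(\|\psi^+\|^2+\|\psi^-\|^2\right)^{q/2}}.$$ Then the limit in the definition of $\tilde{\mathcal S}_d$ exists in $[0,\infty]$ for all $\psi^+,\psi^-\in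 L^2(\mathbb R^d)$, and $$\tilde{\mathcal S}_d=\frac{2^{q/2}}{\sqrt\pi}\,\frac{\Gamma\!\left(\frac{q+1}{2}\right)}{\Gamma\!\left(\frac{q+2}{2}\right)}\,\mathcal S_d .$$ -/

import Mathlib

open MeasureTheory Filter Topology
open scoped FourierTransform ENNReal

/-- The complex Hilbert space `L²(ℝ^d)`. -/
abbrev L2Space (d : ℕ) : Type :=
  Lp ℂ 2 (volume : Measure (EuclideanSpace ℝ (Fin d)))

/-- The symbol of `e^{itΔ/2}`. In Mathlib's normalization `𝓕 ψ ξ = ∫ e^{-2πi⟨x,ξ⟩} ψ(x) dx`, the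
Laplacian is multiplication by `-4π²|ξ|²`, so the symbol is `e^{-2π² i t |ξ|²}`. -/
noncomputable def freeSymbol (d : ℕ) (t : ℝ) (ξ : EuclideanSpace ℝ (Fin d)) : ℂ :=
  Complex.exp (((-(2 * Real.pi ^ 2 * t * ‖ξ‖ ^ 2) : ℝ) : ℂ) * Complex.I)

theorem continuous_freeSymbol (d : ℕ) (t : ℝ) : Continuous (freeSymbol d t) := by
  unfold freeSymbol
  fun_prop

theorem norm_freeSymbol (d : ℕ) (t : ℝ) (ξ : EuclideanSpace ℝ (Fin d)) :
    ‖freeSymbol d t ξ‖ = 1 :=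
  Complex.norm_exp_ofReal_mul_I _

theorem memLp_freeSymbol_mul (d : ℕ) (t : ℝ) (φ : L2Space d) :
    MemLp (fun ξ => freeSymbol d t ξ * φ ξ) 2 volume := by
  refine (Lp.memLp φ).of_le
    ((continuous_freeSymbol d t).aestronglyMeasurable.mul (Lp.memLp φ).aestronglyMeasurable)
    (Eventually.of_forall fun ξ => ?_)
  rw [norm_mul, norm_freeSymbol, one_mul]

/-- The free Schrödinger propagator `e^{itΔ/2}` on `L²(ℝ^d)`, as a Fourier multiplier, with the
unitary Fourier transform of `L²(ℝ^d)`. -/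
noncomputable def schrodinger (d : ℕ) (t : ℝ) (ψ : L2Space d) : L2Space d :=
  𝓕⁻ ((memLp_freeSymbol_mul d t (𝓕 ψ)).toLp : L2Space d)

/-- `∬_{ℝ×ℝ^d} |e^{itΔ/2}ψ(x)|^{2+4/d} dx dt`, in `[0,∞]`. -/
noncomputable def strichartzIntegral (d : ℕ) (ψ : L2Space d) : ℝ≥0∞ :=
  ∫⁻ t : ℝ, ∫⁻ x : EuclideanSpace ℝ (Fin d),
    ‖(schrodinger d t ψ) x‖ₑ ^ (2 + 4 / (d : ℝ))

/-- The Strichartz constant `S_d`: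
`(2π)^{-(d+2)/d} sup_{ψ ≠ 0} ∬ |e^{itΔ/2}ψ(x)|^{2+4/d} dx dt / ‖ψ‖^{2+4/d}`. -/
noncomputable def strichartzConst (d : ℕ) : ℝ≥0∞ :=
  ENNReal.ofReal ((2 * Real.pi) ^ (-(((d : ℝ) + 2) / d))) *
    ⨆ (ψ : L2Space d) (_ : ψ ≠ 0), strichartzIntegral d ψ / ‖ψ‖ₑ ^ (2 + 4 / (d : ℝ))

/-- `∬_{ℝ×ℝ^d} |e^{itΔ/2}ψ⁺(x) + e^{iℓt} e^{-itΔ/2}ψ⁻(x)|^{2+4/d} dx dt`, in `[0,∞]`. The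
oscillating phase depends on the last coordinate of `ℝ^{d+1} = ℝ^d × ℝ`, which is the time `t`. -/
noncomputable def twoProfileIntegral (d : ℕ) (ψp ψm : L2Space d) (ℓ : ℝ) : ℝ≥0∞ :=
  ∫⁻ t : ℝ, ∫⁻ x : EuclideanSpace ℝ (Fin d),
    ‖(schrodinger d t ψp) x +
      Complex.exp (((ℓ * t : ℝ) : ℂ) * Complex.I) * (schrodinger d (-t) ψm) x‖ₑ
        ^ (2 + 4 / (d : ℝ))

/-- The two-profile constant: `(2π)^{-(d+2)/d}` times the supremum over `(ψ⁺,ψ⁻) ≠ (0,0)` of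
`lim_{ℓ→∞} twoProfileIntegral d ψ⁺ ψ⁻ ℓ / (‖ψ⁺‖² + ‖ψ⁻‖²)^{1+2/d}`. -/
noncomputable def twoProfileConst (d : ℕ) : ℝ≥0∞ :=
  ENNReal.ofReal ((2 * Real.pi) ^ (-(((d : ℝ) + 2) / d))) *
    ⨆ (ψp : L2Space d) (ψm : L2Space d) (_ : (ψp, ψm) ≠ (0, 0)),
      limUnder atTop (twoProfileIntegral d ψp ψm) /
        (‖ψp‖ₑ ^ 2 + ‖ψm‖ₑ ^ 2) ^ (1 + 2 / (d : ℝ))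

/-! Let U and V be the space-time profiles of the two solutions. As the modulation frequency tends
to infinity, the fast phase decouples from the profiles, and the integral tends to the integral of
`phaseMean q (U z) (V z)`, where `phaseMean q a b` is the mean of |a + e^{iθ}b|^q over θ
(`tendsto_lintegral_modulated`). The limit may be infinite, and finiteness of the Strichartz
constant is never needed.

Upper bound: pointwise, `phaseMean q a b` is at most `phaseMean q 1 1` times ((|a|² +
|b|²)/2)^{q/2}, with equality when |a| = |b| (`phaseMean_le`, `phaseMean_of_norm_eq`). Minkowski's
inequality in L^{q/2} for |U|² and |V|², followed by the Strichartz bound on each profile, gives the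
sum of the squared masses to the power q/2 (`lintegral_add_sq_rpow_le`).

Sharpness: with ψ⁻ the conjugate of ψ⁺, time reversal gives |U| = |V| almost everywhere, so the
pointwise bound is an equality and the quotient is a fixed multiple of the Strichartz quotient of
ψ⁺. The ratio of the two constants is therefore 2^{-q/2} `phaseMean q 1 1`, and `phaseMean q 1 1` is
a Beta integral. -/

/-! ### Phase averages and their sharp pointwise bound -/

/-- The circle `ℝ/2πℤ` over which phases are averaged. -/
abbrev PhaseCircle : Type := AddCircle (2 * Real.pi)

instance factTwoPiPos : Fact (0 < 2 * Real.pi) := ⟨Real.two_pi_pos⟩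

/-- The unimodular number `e^{iθ}` as a function on `ℝ/2πℤ`. -/
noncomputable def phase (θ : PhaseCircle) : ℂ := (AddCircle.toCircle θ : ℂ)

@[fun_prop]
theorem continuous_phase : Continuous phase :=
  continuous_subtype_val.comp AddCircle.continuous_toCircle

@[fun_prop]
theorem measurable_phase : Measurable phase := continuous_phase.measurable

theorem norm_phase (θ : PhaseCircle) : ‖phase θ‖ = 1 := Circle.norm_coe _

theorem enorm_phase (θ : PhaseCircle) : ‖phase θ‖ₑ = 1 := by
  rw [← ofReal_norm, norm_phase, ENNReal.ofReal_one]

theorem phase_add (θ φ : PhaseCircle) : phase (θ + φ) = phase θ * phase φ := by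
  simp [phase, AddCircle.toCircle_add]

theorem phase_coe (s : ℝ) : phase (s : PhaseCircle) = Complex.exp ((s : ℂ) * Complex.I) := by
  rw [phase, AddCircle.toCircle_apply_mk, Circle.coe_exp]
  congr 2
  push_cast
  field_simp

theorem exists_phase_eq {z : ℂ} (hz : ‖z‖ = 1) : ∃ θ, phase θ = z := by
  refine ⟨(Complex.arg z : ℝ), ?_⟩
  rw [phase_coe]
  simpa [hz] using Complex.norm_mul_exp_arg_mul_I z

theorem exists_norm_mul_phase (z : ℂ) : ∃ θ, (‖z‖ : ℂ) * phase θ = z := by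
  refine ⟨(Complex.arg z : ℝ), ?_⟩
  rw [phase_coe]
  exact Complex.norm_mul_exp_arg_mul_I z

/-- The average of `|a + e^{iθ} b|^q` over the phase `θ`. -/
noncomputable def phaseMean (q : ℝ) (a b : ℂ) : ℝ≥0∞ :=
  ∫⁻ θ, ‖a + phase θ * b‖ₑ ^ q ∂(AddCircle.haarAddCircle : Measure PhaseCircle)

theorem phaseMean_mul_phase_right (q : ℝ) (a b : ℂ) (φ : PhaseCircle) :
    phaseMean q a (phase φ * b) = phaseMean q a b := by
  unfold phaseMean
  rw [← lintegral_add_right_eq_self (fun θ => ‖a + phase θ * b‖ₑ ^ q) φ]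
  simp only [phase_add, mul_assoc]

theorem phaseMean_mul_left (q : ℝ) (hq : 0 ≤ q) (c a b : ℂ) :
    phaseMean q (c * a) (c * b) = ‖c‖ₑ ^ q * phaseMean q a b := by
  unfold phaseMean
  rw [← lintegral_const_mul _ (by fun_prop)]
  refine lintegral_congr fun θ => ?_
  rw [← ENNReal.mul_rpow_of_nonneg _ _ hq, ← enorm_mul]
  ring_nf

/-- The arguments of `a` and `b` are absorbed by a shift of θ, and the common modulus comes out by
homogeneity. This is the equality case of `phaseMean_le`. -/
theorem phaseMean_of_norm_eq (q : ℝ) (hq : 0 ≤ q) {a b : ℂ} (h : ‖a‖ = ‖b‖) :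
    phaseMean q a b = ‖a‖ₑ ^ q * phaseMean q 1 1 := by
  obtain ⟨α, hα⟩ := exists_norm_mul_phase a
  obtain ⟨β, hβ⟩ := exists_norm_mul_phase b
  have hb : b = phase (β - α) * a := by
    rw [← hα, ← hβ, ← h, mul_left_comm, ← phase_add, sub_add_cancel]
  rw [hb, phaseMean_mul_phase_right]
  simpa using phaseMean_mul_left q hq a 1 1

/-- All three squares are affine in the real inner product of `α` and `β`. The weights depend on `r`
and `s` only, so they survive averaging over the phase. -/
theorem norm_add_sq_eq_convex_combination {r s : ℝ} (hrs : 0 < r ^ 2 + s ^ 2)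
    {α β : ℂ} (hα : ‖α‖ = 1) (hβ : ‖β‖ = 1) :
    ‖(r : ℂ) * α + s * β‖ ^ 2 = (r ^ 2 + s ^ 2) / 2 *
      ((1 + 2 * r * s / (r ^ 2 + s ^ 2)) / 2 * ‖α + β‖ ^ 2 +
        (1 - 2 * r * s / (r ^ 2 + s ^ 2)) / 2 * ‖α - β‖ ^ 2) := by
  have h : ‖(r : ℂ) * α + s * β‖ ^ 2 = r ^ 2 + 2 * (r * s * inner ℝ α β) + s ^ 2 := by
    rw [← Complex.real_smul, ← Complex.real_smul, norm_add_sq_real, real_inner_smul_left,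
      real_inner_smul_right, norm_smul, norm_smul, hα, hβ]
    simp [mul_assoc]
  rw [h, norm_add_sq_real, norm_sub_sq_real, hα, hβ]
  field_simp
  ring

/-- Jensen's inequality for x^{q/2}, convex because q ≥ 2, applied to the preceding convex
combination. -/
theorem norm_add_rpow_le {q : ℝ} (hq : 2 ≤ q) {r s : ℝ} (hr : 0 ≤ r) (hs : 0 ≤ s)
    (hrs : 0 < r ^ 2 + s ^ 2) {α β : ℂ} (hα : ‖α‖ = 1) (hβ : ‖β‖ = 1) :
    ‖(r : ℂ) * α + s * β‖ ^ q ≤ ((r ^ 2 + s ^ 2) / 2) ^ (q / 2) *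
      ((1 + 2 * r * s / (r ^ 2 + s ^ 2)) / 2 * ‖α + β‖ ^ q +
        (1 - 2 * r * s / (r ^ 2 + s ^ 2)) / 2 * ‖α - β‖ ^ q) := by
  have key : ∀ x : ℝ, 0 ≤ x → x ^ q = (x ^ 2) ^ (q / 2) := fun x hx => by
    rw [← Real.rpow_natCast_mul hx]; congr 1; push_cast; ring
  have hle : 2 * r * s / (r ^ 2 + s ^ 2) ≤ 1 := by
    rw [div_le_one hrs]; nlinarith [sq_nonneg (r - s)]
  have h0 : 0 ≤ 2 * r * s / (r ^ 2 + s ^ 2) := by positivity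
  rw [key _ (norm_nonneg _), key _ (norm_nonneg (α + β)), key _ (norm_nonneg (α - β)),
    norm_add_sq_eq_convex_combination hrs hα hβ,
    Real.mul_rpow (by positivity) (add_nonneg (by positivity)
      (mul_nonneg (by linarith) (by positivity)))]
  refine mul_le_mul_of_nonneg_left ?_ (by positivity)
  exact (convexOn_rpow (by linarith : 1 ≤ q / 2)).2 (Set.mem_Ici.2 (by positivity))
    (Set.mem_Ici.2 (by positivity)) (by linarith) (by linarith) (by ring)

/-- After averaging `norm_add_rpow_le` over θ, the terms with α + β and α − β have the same mean
`phaseMean q 1 1`, and the weights add up to 1. -/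
theorem phaseMean_le {q : ℝ} (hq : 2 ≤ q) (a b : ℂ) :
    phaseMean q a b ≤
      phaseMean q 1 1 * ((‖a‖ₑ ^ 2 + ‖b‖ₑ ^ 2) / 2) ^ (q / 2) := by
  by_cases h0 : a = 0 ∧ b = 0
  · simp [h0.1, h0.2, phaseMean, ENNReal.zero_rpow_of_pos (by linarith : 0 < q)]
  have hrs : 0 < ‖a‖ ^ 2 + ‖b‖ ^ 2 := by
    by_cases ha : a = 0
    · have : b ≠ 0 := fun h => h0 ⟨ha, h⟩
      positivity
    · positivity
  obtain ⟨α, hα⟩ := exists_norm_mul_phase a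
  obtain ⟨β, hβ⟩ := exists_norm_mul_phase b
  set c : ℝ := 2 * ‖a‖ * ‖b‖ / (‖a‖ ^ 2 + ‖b‖ ^ 2) with hc
  have hle : c ≤ 1 := by
    rw [hc, div_le_one hrs]; nlinarith [sq_nonneg (‖a‖ - ‖b‖)]
  have hc0 : 0 ≤ c := by positivity
  have hpt : ∀ θ, ‖a + phase θ * b‖ₑ ^ q ≤ ((‖a‖ₑ ^ 2 + ‖b‖ₑ ^ 2) / 2) ^ (q / 2) *
      (ENNReal.ofReal ((1 + c) / 2) * ‖phase α + phase θ * phase β‖ₑ ^ q +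
        ENNReal.ofReal ((1 - c) / 2) * ‖phase α + phase θ * (-phase β)‖ₑ ^ q) := by
    intro θ
    have h := norm_add_rpow_le hq (norm_nonneg a) (norm_nonneg b) hrs
      (norm_phase α) (norm_phase (θ + β))
    have h1 : a + phase θ * b = (‖a‖ : ℂ) * phase α + ‖b‖ * phase (θ + β) := by
      rw [phase_add]; nth_rewrite 1 [← hα, ← hβ]; ring
    rw [← h1, ← hc, phase_add] at h
    have h2 := ENNReal.ofReal_le_ofReal h
    have hq0 : 0 ≤ q := by linarith
    rw [ENNReal.ofReal_mul (by positivity), ENNReal.ofReal_add (by positivity)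
      (mul_nonneg (by linarith) (by positivity)), ENNReal.ofReal_mul (by positivity),
      ENNReal.ofReal_mul (by linarith), ← ENNReal.ofReal_rpow_of_nonneg (by positivity) hq0,
      ← ENNReal.ofReal_rpow_of_nonneg (by positivity) hq0,
      ← ENNReal.ofReal_rpow_of_nonneg (by positivity) hq0,
      ← ENNReal.ofReal_rpow_of_nonneg (by positivity) (by linarith),
      ENNReal.ofReal_div_of_pos (by norm_num), ENNReal.ofReal_add (by positivity) (by positivity),
      ENNReal.ofReal_pow (by positivity), ENNReal.ofReal_pow (by positivity)] at h2
    simpa [mul_neg, sub_eq_add_neg] using h2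
  have hmean : ∀ s : ℂ, ‖s‖ = 1 → phaseMean q (phase α) s = phaseMean q 1 1 := fun s hs => by
    rw [phaseMean_of_norm_eq q (by linarith) ((norm_phase α).trans hs.symm), enorm_phase]
    simp
  calc phaseMean q a b ≤ _ := lintegral_mono hpt
    _ = ((‖a‖ₑ ^ 2 + ‖b‖ₑ ^ 2) / 2) ^ (q / 2) * (ENNReal.ofReal ((1 + c) / 2) *
          phaseMean q (phase α) (phase β) + ENNReal.ofReal ((1 - c) / 2) *
          phaseMean q (phase α) (-phase β)) := by
      rw [lintegral_const_mul _ (by fun_prop), lintegral_add_left (by fun_prop),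
        lintegral_const_mul _ (by fun_prop), lintegral_const_mul _ (by fun_prop)]
      rfl
    _ = _ := by
      rw [hmean _ (norm_phase β), hmean _ (by rw [norm_neg, norm_phase]), ← add_mul,
        ← ENNReal.ofReal_add (by linarith) (by linarith)]
      rw [show (1 + c) / 2 + (1 - c) / 2 = 1 by ring, ENNReal.ofReal_one, one_mul, mul_comm]

theorem enorm_rpow_le_of_add_sub {q : ℝ} (hq : 1 ≤ q) (a b : ℂ) :
    ‖a‖ₑ ^ q ≤ 2⁻¹ * (‖a + b‖ₑ ^ q + ‖a - b‖ₑ ^ q) := by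
  have h0 : (0 : ℝ) ≤ q := by linarith
  have h : (2 * ‖a‖ₑ) ^ q ≤ 2 ^ (q - 1) * (‖a + b‖ₑ ^ q + ‖a - b‖ₑ ^ q) := by
    refine le_trans (ENNReal.rpow_le_rpow ?_ h0) (ENNReal.rpow_add_le_mul_rpow_add_rpow _ _ hq)
    calc 2 * ‖a‖ₑ = ‖(a + b) + (a - b)‖ₑ := by
          rw [show (a + b) + (a - b) = 2 * a by ring, enorm_mul]
          congr 1
          rw [← ofReal_norm]; simp
      _ ≤ _ := enorm_add_le _ _
  rw [ENNReal.mul_rpow_of_nonneg _ _ h0, ENNReal.rpow_sub _ _ (by simp) (by simp),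
    ENNReal.rpow_one, div_eq_mul_inv, mul_assoc] at h
  exact (ENNReal.mul_le_mul_iff_right (by simp) (by simp)).1 h

/-- Pairing θ with θ + π reduces this to the convexity bound `enorm_rpow_le_of_add_sub`. With its
companion for `b`, it puts both profiles in L^q once the averaged integral is finite. -/
theorem enorm_rpow_le_phaseMean_left {q : ℝ} (hq : 1 ≤ q) (a b : ℂ) :
    ‖a‖ₑ ^ q ≤ phaseMean q a b := by
  have hneg : phaseMean q a (-b) = phaseMean q a b := by
    obtain ⟨φ, hφ⟩ := exists_phase_eq (z := -1) (by simp)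
    simpa [hφ] using phaseMean_mul_phase_right q a b φ
  have h : ∫⁻ _, ‖a‖ₑ ^ q ∂(AddCircle.haarAddCircle : Measure PhaseCircle) ≤
      2⁻¹ * (phaseMean q a b + phaseMean q a (-b)) := by
    unfold phaseMean
    rw [← lintegral_add_left (by fun_prop), ← lintegral_const_mul _ (by fun_prop)]
    refine lintegral_mono fun θ => ?_
    simpa [sub_eq_add_neg] using enorm_rpow_le_of_add_sub hq a (phase θ * b)
  rw [hneg, ← two_mul, ← mul_assoc, ENNReal.inv_mul_cancel (by simp) (by simp)] at h
  simpa using h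

theorem enorm_rpow_le_phaseMean_right {q : ℝ} (hq : 1 ≤ q) (a b : ℂ) :
    ‖b‖ₑ ^ q ≤ phaseMean q a b := by
  have hneg : phaseMean q (-a) b = phaseMean q a b := by
    obtain ⟨φ, hφ⟩ := exists_phase_eq (z := -1) (by simp)
    rw [← phaseMean_mul_phase_right q (-a) b φ, hφ]
    simpa using phaseMean_mul_left q (by linarith) (-1) a b
  have h : ∫⁻ _, ‖b‖ₑ ^ q ∂(AddCircle.haarAddCircle : Measure PhaseCircle) ≤
      2⁻¹ * (phaseMean q a b + phaseMean q (-a) b) := by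
    unfold phaseMean
    rw [← lintegral_add_left (by fun_prop), ← lintegral_const_mul _ (by fun_prop)]
    refine lintegral_mono fun θ => ?_
    have := enorm_rpow_le_of_add_sub hq (phase θ * b) a
    rw [enorm_mul, enorm_phase, one_mul] at this
    refine this.trans (le_of_eq ?_)
    rw [add_comm _ a, ← enorm_neg (phase θ * b - a), neg_sub, ← enorm_neg (a - phase θ * b)]
    congr 5
    ring
  rw [hneg, ← two_mul, ← mul_assoc, ENNReal.inv_mul_cancel (by simp) (by simp)] at h
  simpa using h

/-! ### The constant `phaseMean q 1 1` -/

open ProbabilityTheory in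
-- The substitution y = cos² x turns the total mass 1 of the Beta((q+1)/2, 1/2) density into a
-- multiple of this integral.
theorem lintegral_cos_rpow {q : ℝ} (hq : 0 < q) :
    ∫⁻ x in Set.Ioo 0 (Real.pi / 2), ENNReal.ofReal (Real.cos x ^ q) =
      ENNReal.ofReal (√Real.pi / 2 * (Real.Gamma ((q + 1) / 2) / Real.Gamma ((q + 2) / 2))) := by
  set a : ℝ := (q + 1) / 2 with ha
  have ha0 : 0 < a := by positivity
  have hB := beta_pos ha0 (by norm_num : (0 : ℝ) < 1 / 2)
  have himg : (fun x => Real.cos x ^ 2) '' Set.Ioo 0 (Real.pi / 2) = Set.Ioo 0 1 := by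
    ext y
    constructor
    · rintro ⟨x, hx, rfl⟩
      have hc := Real.cos_pos_of_mem_Ioo ⟨by linarith [hx.1, Real.pi_pos], hx.2⟩
      have hs := Real.sin_pos_of_mem_Ioo ⟨hx.1, by linarith [hx.2, Real.pi_pos]⟩
      have := Real.sin_sq_add_cos_sq x
      exact ⟨by positivity, by nlinarith⟩
    · intro hy
      have h0 : 0 < √y := Real.sqrt_pos.2 hy.1
      have h1 : √y < 1 := by rw [Real.sqrt_lt' one_pos]; simpa using hy.2
      refine ⟨Real.arccos √y, ⟨Real.arccos_pos.2 h1, Real.arccos_lt_pi_div_two.2 h0⟩, ?_⟩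
      simp only
      rw [Real.cos_arccos (by linarith) h1.le, Real.sq_sqrt hy.1.le]
  have hinj : Set.InjOn (fun x => Real.cos x ^ 2) (Set.Ioo 0 (Real.pi / 2)) := by
    intro x hx y hy h
    have hcx := Real.cos_pos_of_mem_Ioo ⟨by linarith [hx.1, Real.pi_pos], hx.2⟩
    have hcy := Real.cos_pos_of_mem_Ioo ⟨by linarith [hy.1, Real.pi_pos], hy.2⟩
    have h' : Real.cos x = Real.cos y := (sq_eq_sq₀ hcx.le hcy.le).1 h
    exact Real.injOn_cos ⟨hx.1.le, by linarith [hx.2, Real.pi_pos]⟩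
      ⟨hy.1.le, by linarith [hy.2, Real.pi_pos]⟩ h'
  have hderiv : ∀ x ∈ Set.Ioo 0 (Real.pi / 2), HasDerivWithinAt (fun x => Real.cos x ^ 2)
      (2 * Real.cos x * -Real.sin x) (Set.Ioo 0 (Real.pi / 2)) x := fun x _ => by
    simpa using ((Real.hasDerivAt_cos x).fun_pow 2).hasDerivWithinAt
  have h1 := lintegral_betaPDF_eq_one ha0 (by norm_num : (0 : ℝ) < 1 / 2)
  rw [lintegral_betaPDF, ← himg,
    lintegral_image_eq_lintegral_abs_deriv_mul measurableSet_Ioo hderiv hinj] at h1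
  have h2 : ∫⁻ x in Set.Ioo 0 (Real.pi / 2), ENNReal.ofReal |2 * Real.cos x * -Real.sin x| *
      ENNReal.ofReal (1 / beta a (1 / 2) * (Real.cos x ^ 2) ^ (a - 1) *
        (1 - Real.cos x ^ 2) ^ ((1 : ℝ) / 2 - 1)) =
      ENNReal.ofReal (2 / beta a (1 / 2)) *
        ∫⁻ x in Set.Ioo 0 (Real.pi / 2), ENNReal.ofReal (Real.cos x ^ q) := by
    rw [← lintegral_const_mul _ (by fun_prop)]
    refine setLIntegral_congr_fun measurableSet_Ioo fun x hx => ?_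
    have hc := Real.cos_pos_of_mem_Ioo ⟨by linarith [hx.1, Real.pi_pos], hx.2⟩
    have hs := Real.sin_pos_of_mem_Ioo ⟨hx.1, by linarith [hx.2, Real.pi_pos]⟩
    rw [← ENNReal.ofReal_mul (abs_nonneg _), ← ENNReal.ofReal_mul (by positivity)]
    congr 1
    rw [mul_neg, abs_neg, abs_of_pos (by positivity), ← Real.sin_sq,
      ← Real.rpow_natCast_mul hc.le, ← Real.rpow_natCast_mul hs.le]
    have e1 : Real.cos x ^ q = Real.cos x ^ (((2 : ℕ) : ℝ) * (a - 1)) * Real.cos x := by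
      rw [← Real.rpow_add_one hc.ne']; congr 1; rw [ha]; push_cast; ring
    have e2 : Real.sin x ^ (((2 : ℕ) : ℝ) * (1 / 2 - 1)) = (Real.sin x)⁻¹ := by
      rw [← Real.rpow_neg_one]; congr 1; norm_num
    rw [e1, e2]
    field_simp
  rw [h2] at h1
  have h3 : ENNReal.ofReal (2 / beta a (1 / 2)) ≠ 0 := by
    rw [Ne, ENNReal.ofReal_eq_zero, not_le]; positivity
  rw [ENNReal.eq_inv_of_mul_eq_one_left ((mul_comm _ _).trans h1),
    ← ENNReal.ofReal_inv_of_pos (by positivity), beta, Real.Gamma_one_half_eq,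
    show a + 1 / 2 = (q + 2) / 2 by rw [ha]; ring]
  congr 1
  field_simp

theorem norm_one_add_phase {s : ℝ} (hs : s ∈ Set.Icc (-Real.pi) Real.pi) :
    ‖1 + phase (s : PhaseCircle)‖ = 2 * Real.cos (s / 2) := by
  have hc : 0 ≤ Real.cos (s / 2) :=
    Real.cos_nonneg_of_mem_Icc ⟨by linarith [hs.1], by linarith [hs.2]⟩
  rw [← sq_eq_sq₀ (norm_nonneg _) (by positivity), phase_coe, Complex.sq_norm,
    Complex.normSq_apply]
  simp only [Complex.add_re, Complex.one_re, Complex.exp_ofReal_mul_I_re, Complex.add_im,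
    Complex.one_im, Complex.exp_ofReal_mul_I_im, zero_add]
  have h1 : Real.cos s = 2 * Real.cos (s / 2) ^ 2 - 1 := by rw [← Real.cos_two_mul]; ring_nf
  nlinarith [Real.sin_sq_add_cos_sq s]

theorem phaseMean_one_one {q : ℝ} (hq : 0 < q) :
    phaseMean q 1 1 = ENNReal.ofReal (2 ^ q / √Real.pi *
      (Real.Gamma ((q + 1) / 2) / Real.Gamma ((q + 2) / 2))) := by
  -- The period interval starts at −π so that cos(s/2) is nonnegative throughout.
  have h1 : phaseMean q 1 1 = ENNReal.ofReal (2 * Real.pi)⁻¹ *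
      ∫⁻ s in Set.Ioc (-Real.pi) (-Real.pi + 2 * Real.pi), ‖1 + phase (s : PhaseCircle)‖ₑ ^ q := by
    rw [AddCircle.lintegral_preimage (2 * Real.pi) (-Real.pi) (fun θ => ‖1 + phase θ‖ₑ ^ q),
      AddCircle.volume_eq_smul_haarAddCircle, lintegral_smul_measure, smul_eq_mul, ← mul_assoc,
      ← ENNReal.ofReal_mul (by positivity), inv_mul_cancel₀ (by positivity)]
    simp [phaseMean]
  have h2 : ∫⁻ s in Set.Ioc (-Real.pi) (-Real.pi + 2 * Real.pi),
      ‖1 + phase (s : PhaseCircle)‖ₑ ^ q =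
      2 * ∫⁻ s in Set.Ioo 0 Real.pi, ENNReal.ofReal ((2 * Real.cos (s / 2)) ^ q) := by
    have e : ∀ s ∈ Set.Ioo (-Real.pi) Real.pi, ‖1 + phase (s : PhaseCircle)‖ₑ ^ q =
        ENNReal.ofReal ((2 * Real.cos (s / 2)) ^ q) := fun s hs => by
      rw [← ofReal_norm, norm_one_add_phase ⟨hs.1.le, hs.2.le⟩,
        ENNReal.ofReal_rpow_of_nonneg _ hq.le]
      exact mul_nonneg zero_le_two
        (Real.cos_nonneg_of_mem_Icc ⟨by linarith [hs.1], by linarith [hs.2]⟩)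
    rw [show -Real.pi + 2 * Real.pi = Real.pi by ring,
      ← setLIntegral_congr Ioo_ae_eq_Ioc, setLIntegral_congr_fun measurableSet_Ioo e,
      ← Set.Ioc_union_Ioo_eq_Ioo (b := 0) (by linarith [Real.pi_pos]) Real.pi_pos,
      lintegral_union measurableSet_Ioo (by
        rw [Set.disjoint_left]; intro x hx hx'; exact absurd hx'.1 (not_lt.2 hx.2)),
      ← setLIntegral_congr Ioo_ae_eq_Ioc, two_mul]
    congr 1
    have := (Measure.measurePreserving_neg (volume : Measure ℝ)).setLIntegral_comp_preimage_emb
      (MeasurableEquiv.neg ℝ).measurableEmbedding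
      (fun s => ENNReal.ofReal ((2 * Real.cos (s / 2)) ^ q)) (Set.Ioo 0 Real.pi)
    rw [← this]
    simp [neg_div]
  have h3 : ∫⁻ s in Set.Ioo 0 Real.pi, ENNReal.ofReal ((2 * Real.cos (s / 2)) ^ q) =
      ENNReal.ofReal (2 * 2 ^ q) *
        ∫⁻ x in Set.Ioo 0 (Real.pi / 2), ENNReal.ofReal (Real.cos x ^ q) := by
    have himg : (fun x : ℝ => 2 * x) '' Set.Ioo 0 (Real.pi / 2) = Set.Ioo 0 Real.pi := by
      rw [Set.image_mul_left_Ioo two_pos]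
      congr 1 <;> ring
    rw [← himg, lintegral_image_eq_lintegral_abs_deriv_mul measurableSet_Ioo (f' := fun _ => 2)
      (fun x _ => by simpa using ((hasDerivAt_id x).const_mul 2).hasDerivWithinAt)
      (fun x _ y _ h => by simpa using h), ← lintegral_const_mul _ (by fun_prop)]
    refine setLIntegral_congr_fun measurableSet_Ioo fun x hx => ?_
    have hc := Real.cos_pos_of_mem_Ioo ⟨by linarith [hx.1, Real.pi_pos], hx.2⟩
    rw [← ENNReal.ofReal_mul (abs_nonneg _), ← ENNReal.ofReal_mul (by positivity),
      abs_of_pos two_pos, mul_div_cancel_left₀ _ two_ne_zero, Real.mul_rpow zero_le_two hc.le,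
      mul_assoc]
  have hG := Real.Gamma_pos_of_pos (show 0 < (q + 1) / 2 by positivity)
  have hG' := Real.Gamma_pos_of_pos (show 0 < (q + 2) / 2 by positivity)
  rw [h1, h2, h3, lintegral_cos_rpow hq, ← ENNReal.ofReal_mul (by positivity),
    show (2 : ℝ≥0∞) = ENNReal.ofReal 2 by simp, ← ENNReal.ofReal_mul (by positivity),
    ← ENNReal.ofReal_mul (by positivity)]
  congr 1
  have := Real.mul_self_sqrt Real.pi_pos.le
  have h5 : 0 < √Real.pi := Real.sqrt_pos.2 Real.pi_pos
  field_simp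
  rw [Real.sq_sqrt Real.pi_pos.le]

/-! ### Averaging of a fast phase -/

theorem tendsto_eLpNorm_translate_sub {X F : Type*} [NormedAddCommGroup X] [MeasurableSpace X]
    [BorelSpace X] [SecondCountableTopology X] [LocallyCompactSpace X] [NormedAddCommGroup F]
    {μ : Measure X}
    [IsFiniteMeasureOnCompacts μ] [μ.IsAddLeftInvariant] {p : ℝ≥0∞} (hp1 : 1 ≤ p) (hp : p ≠ ∞)
    {U : X → F} (hU : MemLp U p μ) :
    Tendsto (fun h : X => eLpNorm (fun z => U (h + z) - U z) p μ) (𝓝 0) (𝓝 0) := by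
  have : Fact (1 ≤ p) := ⟨hp1⟩
  have : Fact (p ≠ ∞) := ⟨hp⟩
  have hc : Continuous fun h : X => DomAddAct.mk h +ᵥ hU.toLp :=
    (DomAddAct.continuous_mk).vadd continuous_const
  have ht := (tendsto_iff_edist_tendsto_0.1 (hc.tendsto 0))
  refine ht.congr fun h => ?_
  rw [DomAddAct.mk_vadd_toLp, DomAddAct.mk_vadd_toLp, Lp.edist_toLp_toLp]
  congr 1
  ext z
  simp

/-- The modulation `e^{iℓt}` on `ℝ × E`. -/
noncomputable def timePhase {E : Type*} (ℓ : ℝ) (z : ℝ × E) : ℂ :=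
  Complex.exp (((ℓ * z.1 : ℝ) : ℂ) * Complex.I)

@[fun_prop]
theorem measurable_timePhase {E : Type*} [MeasurableSpace E] (ℓ : ℝ) : Measurable (timePhase (E := E) ℓ) := by
  unfold timePhase
  fun_prop

theorem norm_timePhase {E : Type*} (ℓ : ℝ) (z : ℝ × E) : ‖timePhase ℓ z‖ = 1 :=
  Complex.norm_exp_ofReal_mul_I _

/-- A time shift by s/ℓ advances the fast phase by exactly s, yet tends to 0 as ℓ grows, so the
profiles barely notice it. -/
theorem timePhase_add {E : Type*} [AddZeroClass E] (ℓ s : ℝ) (hℓ : ℓ ≠ 0) (z : ℝ × E) :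
    timePhase ℓ ((s / ℓ, 0) + z) = phase (s : PhaseCircle) * timePhase ℓ z := by
  rw [phase_coe, timePhase, timePhase, ← Complex.exp_add]
  congr 1
  push_cast
  simp only [Prod.fst_add, Complex.ofReal_add, Complex.ofReal_div]
  have : (ℓ : ℂ) ≠ 0 := by exact_mod_cast hℓ
  field_simp

theorem phaseMean_timePhase {E : Type*} (q : ℝ) (a b : ℂ) (ℓ : ℝ) (z : ℝ × E) :
    phaseMean q a (timePhase ℓ z * b) = phaseMean q a b := by
  obtain ⟨φ, hφ⟩ := exists_phase_eq (norm_timePhase ℓ z)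
  rw [← hφ, phaseMean_mul_phase_right]

theorem exists_coe_mem_Icc (θ : PhaseCircle) :
    ∃ s ∈ Set.Icc (0 : ℝ) (2 * Real.pi), (s : PhaseCircle) = θ := by
  refine ⟨AddCircle.equivIco (2 * Real.pi) 0 θ, ?_, AddCircle.coe_equivIco⟩
  have h := (AddCircle.equivIco (2 * Real.pi) 0 θ).2
  exact ⟨h.1, by simpa using h.2.le⟩

theorem measurable_phaseMean_comp {X : Type*} [MeasurableSpace X] (q : ℝ) {U V : X → ℂ}
    (hU : Measurable U) (hV : Measurable V) :
    Measurable fun z => phaseMean q (U z) (V z) := by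
  unfold phaseMean
  have h : Measurable fun y : X × PhaseCircle => ‖U y.1 + phase y.2 * V y.1‖ₑ ^ q := by fun_prop
  exact h.lintegral_prod_right'

theorem lintegral_phaseMean {X : Type*} [MeasurableSpace X] (ν : Measure X) [SFinite ν] (q : ℝ)
    {U V : X → ℂ} (hU : Measurable U) (hV : Measurable V) :
    ∫⁻ z, phaseMean q (U z) (V z) ∂ν =
      ∫⁻ θ, ∫⁻ z, ‖U z + phase θ * V z‖ₑ ^ q ∂ν ∂AddCircle.haarAddCircle := by
  unfold phaseMean
  rw [lintegral_lintegral_swap]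
  exact Measurable.aemeasurable (by fun_prop)

section Modulation

variable {E : Type*} [NormedAddCommGroup E] [NormedSpace ℝ E] [FiniteDimensional ℝ E]
  [MeasurableSpace E] [BorelSpace E]

variable {μ : Measure (ℝ × E)} [μ.IsAddHaarMeasure]

theorem eventually_translation_small {p : ℝ≥0∞} (hp1 : 1 ≤ p) (hp : p ≠ ∞) {U : ℝ × E → ℂ}
    (hU : MemLp U p μ) {ε : ℝ≥0∞} (hε : 0 < ε) :
    ∀ᶠ ℓ : ℝ in atTop, ∀ s ∈ Set.Icc (0 : ℝ) (2 * Real.pi),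
      eLpNorm (fun z => U ((s / ℓ, 0) + z) - U z) p μ ≤ ε := by
  have h := (tendsto_eLpNorm_translate_sub hp1 hp hU).eventually (ge_mem_nhds hε)
  obtain ⟨δ, hδ, hball⟩ := Metric.eventually_nhds_iff.1 h
  filter_upwards [eventually_gt_atTop (0 : ℝ), eventually_gt_atTop (2 * Real.pi / δ)] with ℓ h0 hℓ
  intro s hs
  refine hball ?_
  rw [dist_zero_right, Prod.norm_mk, norm_zero, max_eq_left (norm_nonneg _), Real.norm_eq_abs,
    abs_of_nonneg (div_nonneg hs.1 h0.le), div_lt_iff₀ h0]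
  rw [div_lt_iff₀ hδ] at hℓ
  linarith [hs.2]

/-- Translation preserves the L^p norm. Translating the modulated sum by s/ℓ rotates its phase by s,
at the cost of one error ε for each profile. -/
theorem eLpNorm_translate_modulate_le {p : ℝ≥0∞} (hp1 : 1 ≤ p) {U V : ℝ × E → ℂ}
    (hU : Measurable U) (hV : Measurable V) {ε : ℝ≥0∞} {ℓ s : ℝ} (hℓ : ℓ ≠ 0)
    (hUε : eLpNorm (fun z => U ((s / ℓ, 0) + z) - U z) p μ ≤ ε)
    (hVε : eLpNorm (fun z => V ((s / ℓ, 0) + z) - V z) p μ ≤ ε) :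
    eLpNorm (fun z => U z + timePhase ℓ z * V z) p μ ≤
        eLpNorm (fun z => U z + phase s * (timePhase ℓ z * V z)) p μ + 2 * ε ∧
      eLpNorm (fun z => U z + phase s * (timePhase ℓ z * V z)) p μ ≤
        eLpNorm (fun z => U z + timePhase ℓ z * V z) p μ + 2 * ε := by
  set h : ℝ × E := (s / ℓ, 0) with hh
  set W : ℝ × E → ℂ := fun z => U z + timePhase ℓ z * V z with hW
  set W' : ℝ × E → ℂ := fun z => U z + phase s * (timePhase ℓ z * V z) with hW'
  have hWm : Measurable W := by fun_prop
  have hW'm : Measurable W' := by fun_prop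
  have hUh : Measurable fun z => U (h + z) := hU.comp (measurable_const_add h)
  have hVh : Measurable fun z => V (h + z) := hV.comp (measurable_const_add h)
  have htr : eLpNorm (W ∘ (h + ·)) p μ = eLpNorm W p μ :=
    eLpNorm_comp_measurePreserving hWm.aestronglyMeasurable (measurePreserving_add_left μ h)
  have hmod : eLpNorm (fun z => phase s * timePhase ℓ z * (V (h + z) - V z)) p μ =
      eLpNorm (fun z => V (h + z) - V z) p μ :=
    eLpNorm_congr_norm_ae (Eventually.of_forall fun z => by
      rw [norm_mul, norm_mul, norm_phase, norm_timePhase, one_mul, one_mul])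
  have hdiff : eLpNorm (W ∘ (h + ·) - W') p μ ≤ 2 * ε := by
    have e : W ∘ (h + ·) - W' = (fun z => U (h + z) - U z) +
        fun z => phase s * timePhase ℓ z * (V (h + z) - V z) := by
      ext z
      simp only [hW, hW', Function.comp, Pi.sub_apply, Pi.add_apply, hh, timePhase_add ℓ s hℓ]
      ring
    rw [e]
    refine (eLpNorm_add_le (hUh.sub hU).aestronglyMeasurable
      (Measurable.aestronglyMeasurable (by fun_prop)) hp1).trans ?_
    rw [hmod, two_mul]
    exact add_le_add hUε hVε
  have hWh : Measurable (W ∘ (h + ·)) := hWm.comp (measurable_const_add h)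
  constructor
  · calc eLpNorm W p μ = eLpNorm (W' + (W ∘ (h + ·) - W')) p μ := by rw [add_sub_cancel, htr]
      _ ≤ _ := (eLpNorm_add_le hW'm.aestronglyMeasurable
        (hWh.sub hW'm).aestronglyMeasurable hp1).trans (add_le_add_right hdiff _)
  · calc eLpNorm W' p μ = eLpNorm (W ∘ (h + ·) - (W ∘ (h + ·) - W')) p μ := by rw [sub_sub_cancel]
      _ ≤ _ := (eLpNorm_sub_le hWh.aestronglyMeasurable
        (hWh.sub hW'm).aestronglyMeasurable hp1).trans (by
          rw [htr]; exact add_le_add_right hdiff _)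

/-- For large ℓ, the norms obtained by rotating the phase through any θ agree with the unrotated one
up to 2ε. Their q-th powers average to the claimed limit. -/
theorem tendsto_lintegral_modulated_of_memLp {q : ℝ} (hq : 1 ≤ q) {U V : ℝ × E → ℂ}
    (hU : Measurable U) (hV : Measurable V) (hUq : MemLp U (ENNReal.ofReal q) μ)
    (hVq : MemLp V (ENNReal.ofReal q) μ) :
    Tendsto (fun ℓ : ℝ => ∫⁻ z, ‖U z + timePhase ℓ z * V z‖ₑ ^ q ∂μ) atTop
      (𝓝 (∫⁻ z, phaseMean q (U z) (V z) ∂μ)) := by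
  have hq0 : 0 < q := by linarith
  have hp1 : 1 ≤ ENNReal.ofReal q := by simpa using ENNReal.ofReal_le_ofReal hq
  have hnorm : ∀ f : ℝ × E → ℂ, eLpNorm f (ENNReal.ofReal q) μ ^ q = ∫⁻ z, ‖f z‖ₑ ^ q ∂μ := by
    intro f
    rw [eLpNorm_eq_lintegral_rpow_enorm_toReal (by simpa using hq0) ENNReal.ofReal_ne_top,
      ENNReal.toReal_ofReal hq0.le, ← ENNReal.rpow_mul, one_div_mul_cancel hq0.ne',
      ENNReal.rpow_one]
  set A := ∫⁻ z, phaseMean q (U z) (V z) ∂μ with hA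
  -- By Tonelli and rotation invariance the θ-average is the same for every ℓ.
  have hAℓ : ∀ ℓ : ℝ, A = ∫⁻ θ, (eLpNorm (fun z => U z + phase θ * (timePhase ℓ z * V z))
      (ENNReal.ofReal q) μ) ^ q ∂(AddCircle.haarAddCircle : Measure PhaseCircle) := by
    intro ℓ
    simp_rw [hnorm]
    rw [← lintegral_phaseMean μ q hU (by fun_prop)]
    simp_rw [phaseMean_timePhase]
    rfl
  have hle : ∀ ε : ℝ≥0∞, 0 < ε → ∀ᶠ ℓ : ℝ in atTop,
      A ^ q⁻¹ ≤ eLpNorm (fun z => U z + timePhase ℓ z * V z) (ENNReal.ofReal q) μ + 2 * ε ∧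
      eLpNorm (fun z => U z + timePhase ℓ z * V z) (ENNReal.ofReal q) μ ≤ A ^ q⁻¹ + 2 * ε := by
    intro ε hε
    filter_upwards [eventually_translation_small hp1 ENNReal.ofReal_ne_top hUq hε,
      eventually_translation_small hp1 ENNReal.ofReal_ne_top hVq hε, eventually_gt_atTop 0]
      with ℓ h1 h2 h0
    have key : ∀ θ : PhaseCircle,
        eLpNorm (fun z => U z + timePhase ℓ z * V z) (ENNReal.ofReal q) μ ≤
          eLpNorm (fun z => U z + phase θ * (timePhase ℓ z * V z)) (ENNReal.ofReal q) μ + 2 * ε ∧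
        eLpNorm (fun z => U z + phase θ * (timePhase ℓ z * V z)) (ENNReal.ofReal q) μ ≤
          eLpNorm (fun z => U z + timePhase ℓ z * V z) (ENNReal.ofReal q) μ + 2 * ε := fun θ => by
      obtain ⟨s, hs, hsθ⟩ := exists_coe_mem_Icc θ
      have := eLpNorm_translate_modulate_le hp1 hU hV h0.ne' (h1 s hs) (h2 s hs)
      rw [hsθ] at this
      exact this
    constructor
    · rw [ENNReal.rpow_inv_le_iff hq0, hAℓ ℓ]
      calc _ ≤ ∫⁻ _, (eLpNorm (fun z => U z + timePhase ℓ z * V z) (ENNReal.ofReal q) μ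
            + 2 * ε) ^ q ∂(AddCircle.haarAddCircle : Measure PhaseCircle) :=
            lintegral_mono fun θ => ENNReal.rpow_le_rpow (key θ).2 hq0.le
        _ = _ := by simp
    · rw [← tsub_le_iff_right, ENNReal.le_rpow_inv_iff hq0, hAℓ ℓ]
      calc _ = ∫⁻ _, (eLpNorm (fun z => U z + timePhase ℓ z * V z) (ENNReal.ofReal q) μ
            - 2 * ε) ^ q ∂(AddCircle.haarAddCircle : Measure PhaseCircle) := by simp
        _ ≤ _ := lintegral_mono fun θ =>
            ENNReal.rpow_le_rpow (tsub_le_iff_right.2 (key θ).1) hq0.le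
  have hfin : A ^ q⁻¹ ≠ ∞ := by
    obtain ⟨ℓ, hℓ⟩ := (hle 1 one_pos).exists
    refine ne_top_of_le_ne_top (ENNReal.add_ne_top.2 ⟨?_, by simp⟩) hℓ.1
    refine (hUq.add (hVq.of_le (f := fun z => timePhase ℓ z * V z)
      (Measurable.aestronglyMeasurable (by fun_prop)) (Eventually.of_forall fun z => ?_))).2.ne
    rw [norm_mul, norm_timePhase, one_mul]
  have hlim : Tendsto (fun ℓ : ℝ => eLpNorm (fun z => U z + timePhase ℓ z * V z)
      (ENNReal.ofReal q) μ) atTop (𝓝 (A ^ q⁻¹)) := by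
    rw [ENNReal.tendsto_nhds hfin]
    intro ε hε
    have h2 : 2 * (ε / 2) = ε := ENNReal.mul_div_cancel (by simp) (by simp)
    filter_upwards [hle (ε / 2) (ENNReal.half_pos hε.ne')] with ℓ hℓ
    rw [h2] at hℓ
    exact ⟨tsub_le_iff_right.2 hℓ.1, hℓ.2⟩
  have := (ENNReal.continuous_rpow_const (y := q)).continuousAt.tendsto.comp hlim
  rw [← ENNReal.rpow_mul, inv_mul_cancel₀ hq0.ne', ENNReal.rpow_one] at this
  exact this.congr fun ℓ => hnorm _

/-- No integrability is assumed: the limit theorem applies on sets of finite measure where both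
profiles are bounded, and these sets exhaust the space. -/
theorem lintegral_phaseMean_le_liminf {q : ℝ} (hq : 1 ≤ q) {U V : ℝ × E → ℂ}
    (hU : Measurable U) (hV : Measurable V) :
    ∫⁻ z, phaseMean q (U z) (V z) ∂μ ≤
      liminf (fun ℓ : ℝ => ∫⁻ z, ‖U z + timePhase ℓ z * V z‖ₑ ^ q ∂μ) atTop := by
  have hq0 : 0 < q := by linarith
  set K : ℕ → Set (ℝ × E) := fun n => spanningSets μ n ∩ {z | ‖U z‖ ≤ n} ∩ {z | ‖V z‖ ≤ n} with hK
  have hKm : ∀ n, MeasurableSet (K n) := fun n =>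
    ((measurableSet_spanningSets μ n).inter (measurableSet_le hU.norm measurable_const)).inter
      (measurableSet_le hV.norm measurable_const)
  have hKmono : Monotone K := fun m n hmn z hz =>
    have hc : (m : ℝ) ≤ n := by exact_mod_cast hmn
    ⟨⟨monotone_spanningSets μ hmn hz.1.1, le_trans hz.1.2 hc⟩, le_trans hz.2 hc⟩
  have hKun : ⋃ n, K n = Set.univ := by
    refine Set.eq_univ_of_forall fun z => ?_
    obtain ⟨n, hn⟩ := Set.mem_iUnion.1 ((iUnion_spanningSets μ).symm ▸ Set.mem_univ z)
    obtain ⟨m, hm⟩ := exists_nat_ge (max ‖U z‖ ‖V z‖)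
    have hc : (m : ℝ) ≤ (max n m : ℕ) := by exact_mod_cast le_max_right n m
    exact Set.mem_iUnion.2 ⟨max n m, ⟨monotone_spanningSets μ (le_max_left n m) hn,
      ((le_max_left _ _).trans hm).trans hc⟩, ((le_max_right _ _).trans hm).trans hc⟩
  have hmem : ∀ n, ∀ f : ℝ × E → ℂ, Measurable f → (∀ z ∈ K n, ‖f z‖ ≤ n) →
      MemLp ((K n).indicator f) (ENNReal.ofReal q) μ := by
    intro n f hf hfn
    rw [memLp_indicator_iff_restrict (hKm n)]
    have : IsFiniteMeasure (μ.restrict (K n)) := ⟨by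
      rw [Measure.restrict_apply_univ]
      exact (measure_mono (Set.inter_subset_left.trans Set.inter_subset_left)).trans_lt
        (measure_spanningSets_lt_top μ n)⟩
    exact MemLp.of_bound hf.aestronglyMeasurable n
      ((ae_restrict_iff' (hKm n)).2 (Eventually.of_forall hfn))
  have hn : ∀ n, ∫⁻ z in K n, phaseMean q (U z) (V z) ∂μ ≤
      liminf (fun ℓ : ℝ => ∫⁻ z, ‖U z + timePhase ℓ z * V z‖ₑ ^ q ∂μ) atTop := by
    intro n
    have ht := tendsto_lintegral_modulated_of_memLp (μ := μ) hq (hU.indicator (hKm n))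
      (hV.indicator (hKm n)) (hmem n U hU fun z hz => hz.1.2) (hmem n V hV fun z hz => hz.2)
    rw [← lintegral_indicator (hKm n)]
    have e : (K n).indicator (fun z => phaseMean q (U z) (V z)) =
        fun z => phaseMean q ((K n).indicator U z) ((K n).indicator V z) := by
      ext z
      by_cases hz : z ∈ K n
      · simp [hz]
      · simp [hz, phaseMean, ENNReal.zero_rpow_of_pos hq0]
    rw [e, ← ht.liminf_eq]
    refine liminf_le_liminf (Eventually.of_forall fun ℓ => lintegral_mono fun z => ?_)
    by_cases hz : z ∈ K n
    · simp [hz]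
    · simp [hz, ENNReal.zero_rpow_of_pos hq0]
  rw [← setLIntegral_univ, ← hKun, setLIntegral_iUnion_of_directed _ hKmono.directed_le]
  exact iSup_le hn

theorem tendsto_lintegral_modulated {q : ℝ} (hq : 1 ≤ q) {U V : ℝ × E → ℂ}
    (hU : Measurable U) (hV : Measurable V) :
    Tendsto (fun ℓ : ℝ => ∫⁻ z, ‖U z + timePhase ℓ z * V z‖ₑ ^ q ∂μ) atTop
      (𝓝 (∫⁻ z, phaseMean q (U z) (V z) ∂μ)) := by
  have hq0 : 0 < q := by linarith
  -- If the averaged integral is infinite, the liminf bound suffices; if it is finite, both profiles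
  -- lie in L^q.
  by_cases hA : ∫⁻ z, phaseMean q (U z) (V z) ∂μ = ∞
  · refine tendsto_of_le_liminf_of_limsup_le (lintegral_phaseMean_le_liminf hq hU hV) ?_
    rw [hA]
    exact le_top
  · have hmem : ∀ f : ℝ × E → ℂ, Measurable f →
        (∀ z, ‖f z‖ₑ ^ q ≤ phaseMean q (U z) (V z)) → MemLp f (ENNReal.ofReal q) μ := by
      intro f hf hle
      refine ⟨hf.aestronglyMeasurable, ?_⟩
      rw [eLpNorm_lt_top_iff_lintegral_rpow_enorm_lt_top (by simpa using hq0) ENNReal.ofReal_ne_top,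
        ENNReal.toReal_ofReal hq0.le]
      exact (lintegral_mono hle).trans_lt (lt_top_iff_ne_top.2 hA)
    exact tendsto_lintegral_modulated_of_memLp hq hU hV
      (hmem U hU fun z => enorm_rpow_le_phaseMean_left hq _ _)
      (hmem V hV fun z => enorm_rpow_le_phaseMean_right hq _ _)

end Modulation

/-! ### Jointly measurable versions -/

/-- A family of `L^p` functions that is measurable in its parameter has a jointly measurable
version. -/
theorem exists_jointly_measurable_version {T X F : Type*} [MeasurableSpace T] [MeasurableSpace X]
    [NormedAddCommGroup F] [CompleteSpace F] [MeasurableSpace F] [BorelSpace F]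
    {μ : Measure X} {p : ℝ≥0∞} [Fact (1 ≤ p)] [SecondCountableTopology F]
    [TopologicalSpace.SeparableSpace (Lp F p μ)] (f : T → Lp F p μ)
    (hf : ∀ g : Lp F p μ, Measurable fun t => edist (f t) g) :
    ∃ U : T × X → F, Measurable U ∧ ∀ t, (fun x => U (t, x)) =ᵐ[μ] f t := by
  classical
  have hp1 : 1 ≤ p := Fact.out
  set e : ℕ → Lp F p μ := TopologicalSpace.denseSeq (Lp F p μ)
  -- Choosing the least admissible index makes the approximant measurable in `t`. The exponent n + 1
  -- makes any two approximants of index at least M differ by less than 2^{-M}, which is summable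
  -- and forces almost everywhere convergence.
  have hex : ∀ (n : ℕ) (t : T), ∃ k, edist (f t) (e k) < (2⁻¹ : ℝ≥0∞) ^ (n + 1) := fun n t => by
    obtain ⟨_, ⟨k, rfl⟩, hk⟩ := EMetric.mem_closure_iff.1
      (TopologicalSpace.denseRange_denseSeq (Lp F p μ) (f t)) ((2⁻¹ : ℝ≥0∞) ^ (n + 1))
      (ENNReal.pow_pos (by simp) _)
    exact ⟨k, hk⟩
  set N : ℕ → T → ℕ := fun n t => Nat.find (hex n t)
  have hN : ∀ n t, edist (f t) (e (N n t)) < (2⁻¹ : ℝ≥0∞) ^ (n + 1) := fun n t =>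
    Nat.find_spec (hex n t)
  have hNm : ∀ n, Measurable (N n) := fun n =>
    measurable_find (hex n) fun k => measurableSet_lt (hf (e k)) measurable_const
  set V : ℕ → T × X → F := fun n z => e (N n z.1) z.2
  have hem : Measurable fun y : ℕ × X => e y.1 y.2 :=
    measurable_from_prod_countable_right fun k => (Lp.stronglyMeasurable (e k)).measurable
  have hV : ∀ n, Measurable (V n) := fun n =>
    hem.comp (((hNm n).comp measurable_fst).prodMk measurable_snd)
  refine ⟨fun z => limUnder atTop fun n => V n z,
    (StronglyMeasurable.limUnder fun n => (hV n).stronglyMeasurable).measurable, fun t => ?_⟩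
  have hdist : ∀ n, eLpNorm (⇑(e (N n t)) - ⇑(f t)) p μ < (2⁻¹ : ℝ≥0∞) ^ (n + 1) := fun n => by
    rw [← Lp.edist_def, edist_comm]
    exact hN n t
  have hsm : ∀ n, AEStronglyMeasurable (⇑(e (N n t))) μ := fun n =>
    (Lp.stronglyMeasurable _).aestronglyMeasurable
  have hanti : ∀ {m n : ℕ}, m ≤ n → (2⁻¹ : ℝ≥0∞) ^ (n + 1) ≤ 2⁻¹ ^ (m + 1) := fun h =>
    pow_le_pow_right_of_le_one' (by simp) (by omega)
  have hex_lim : ∀ᵐ x ∂μ, ∃ l : F, Tendsto (fun n => e (N n t) x) atTop (𝓝 l) := by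
    refine Lp.ae_tendsto_of_cauchy_eLpNorm (B := fun n => (2⁻¹ : ℝ≥0∞) ^ n) hsm hp1 ?_ ?_
    · rw [ENNReal.tsum_geometric]; simp
    · intro M n m hn hm
      rw [← Lp.edist_def]
      calc edist (e (N n t)) (e (N m t)) ≤ edist (f t) (e (N n t)) + edist (f t) (e (N m t)) :=
            edist_triangle_left _ _ _
        _ < 2⁻¹ ^ (M + 1) + 2⁻¹ ^ (M + 1) :=
            ENNReal.add_lt_add ((hN n t).trans_le (hanti hn)) ((hN m t).trans_le (hanti hm))
        _ = 2⁻¹ ^ M := by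
            rw [← two_mul, pow_succ', ← mul_assoc, ENNReal.mul_inv_cancel (by simp) (by simp),
              one_mul]
  have hlim0 : Tendsto (fun n => eLpNorm (⇑(e (N n t)) - ⇑(f t)) p μ) atTop (𝓝 0) := by
    refine tendsto_of_tendsto_of_tendsto_of_le_of_le tendsto_const_nhds ?_ (fun n => zero_le)
      fun n => (hdist n).le
    exact (ENNReal.tendsto_pow_atTop_nhds_zero_of_lt_one (by simp)).comp (tendsto_add_atTop_nat 1)
  -- Convergence in measure yields a subsequence tending to `f t`, which identifies the almost
  -- everywhere limit.
  obtain ⟨ns, hns, hae⟩ := (tendstoInMeasure_of_tendsto_eLpNorm (zero_lt_one.trans_le hp1).ne' hsm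
    (Lp.stronglyMeasurable (f t)).aestronglyMeasurable hlim0).exists_seq_tendsto_ae
  filter_upwards [hex_lim, hae] with x ⟨l, hl⟩ hx
  rw [← tendsto_nhds_unique (hl.comp hns.tendsto_atTop) hx]
  exact hl.limUnder_eq

/-! ### The Schrödinger flow: measurability and time reversal -/

section Schrodinger

variable (d : ℕ)

/-- Multiplication by the symbol `freeSymbol d t` on `L²`. -/
noncomputable def mulFreeSymbol (t : ℝ) (φ : L2Space d) : L2Space d :=
  (memLp_freeSymbol_mul d t φ).toLp

theorem coeFn_mulFreeSymbol (t : ℝ) (φ : L2Space d) :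
    mulFreeSymbol d t φ =ᵐ[volume] fun ξ => freeSymbol d t ξ * φ ξ :=
  MemLp.coeFn_toLp _

theorem schrodinger_eq (t : ℝ) (ψ : L2Space d) :
    schrodinger d t ψ = 𝓕⁻ (mulFreeSymbol d t (𝓕 ψ)) := rfl

theorem edist_fourierInv (f g : L2Space d) : edist (𝓕⁻ f : L2Space d) (𝓕⁻ g) = edist f g :=
  (Lp.fourierTransformₗᵢ (EuclideanSpace ℝ (Fin d)) ℂ).symm.isometry.edist_eq f g

theorem continuous_freeSymbol_prod :
    Continuous fun z : ℝ × EuclideanSpace ℝ (Fin d) => freeSymbol d z.1 z.2 := by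
  unfold freeSymbol
  fun_prop

/-- By Plancherel the distance is an integral on the Fourier side, where the integrand is jointly
measurable in time and frequency. -/
theorem measurable_edist_schrodinger (ψ g : L2Space d) :
    Measurable fun t => edist (schrodinger d t ψ) g := by
  have h : ∀ t, edist (schrodinger d t ψ) g =
      (∫⁻ ξ, ‖freeSymbol d t ξ * (𝓕 ψ : L2Space d) ξ - (𝓕 g : L2Space d) ξ‖ₑ ^ (2 : ℝ)) ^
        (1 / (2 : ℝ)) := by
    intro t
    have hg : g = 𝓕⁻ (𝓕 g : L2Space d) := (FourierTransform.fourierInv_fourier_eq g).symm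
    rw [schrodinger_eq, hg, edist_fourierInv, ← hg, Lp.edist_def,
      eLpNorm_eq_lintegral_rpow_enorm_toReal two_ne_zero ENNReal.ofNat_ne_top]
    simp only [ENNReal.toReal_ofNat]
    congr 1
    refine lintegral_congr_ae ?_
    filter_upwards [coeFn_mulFreeSymbol d t (𝓕 ψ)] with ξ hξ
    rw [Pi.sub_apply, hξ]
  simp_rw [h]
  refine Measurable.pow_const ?_ _
  have hm := (continuous_freeSymbol_prod d).measurable
  have hs : ∀ f : L2Space d,
      Measurable fun z : ℝ × EuclideanSpace ℝ (Fin d) => f z.2 := fun f =>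
    (Lp.stronglyMeasurable f).measurable.comp measurable_snd
  exact (((hm.mul (hs (𝓕 ψ))).sub (hs (𝓕 g))).enorm.pow_const 2).lintegral_prod_right'

theorem exists_measurable_schrodinger (ψ : L2Space d) :
    ∃ U : ℝ × EuclideanSpace ℝ (Fin d) → ℂ, Measurable U ∧
      ∀ t, (fun x => U (t, x)) =ᵐ[volume] schrodinger d t ψ := by
  have : Fact ((2 : ℝ≥0∞) ≠ ∞) := ⟨ENNReal.ofNat_ne_top⟩
  exact exists_jointly_measurable_version _ (measurable_edist_schrodinger d ψ)

theorem continuous_fourierL2 : Continuous fun f : L2Space d => (𝓕 f : L2Space d) :=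
  (Lp.fourierTransformₗᵢ (EuclideanSpace ℝ (Fin d)) ℂ).continuous

theorem continuous_fourierInvL2 : Continuous fun f : L2Space d => (𝓕⁻ f : L2Space d) :=
  (Lp.fourierTransformₗᵢ (EuclideanSpace ℝ (Fin d)) ℂ).symm.continuous

/-- Complex conjugation on `L²(ℝ^d)`. -/
noncomputable def conjL2 : L2Space d →L[ℝ] L2Space d :=
  (Complex.conjCLE : ℂ →L[ℝ] ℂ).compLpL 2 volume

theorem coeFn_conjL2 (f : L2Space d) :
    conjL2 d f =ᵐ[volume] fun x => starRingEnd ℂ (f x) :=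
  ContinuousLinearMap.coeFn_compLpL _ f

theorem enorm_conjL2 (f : L2Space d) : ‖conjL2 d f‖ₑ = ‖f‖ₑ := by
  rw [Lp.enorm_def, Lp.enorm_def]
  refine eLpNorm_congr_norm_ae ?_
  filter_upwards [coeFn_conjL2 d f] with x hx
  rw [hx, RCLike.norm_conj]

/-- The reflection `x ↦ -x` on `L²(ℝ^d)`. -/
noncomputable def reflectL2 : L2Space d →+ L2Space d :=
  Lp.compMeasurePreserving Neg.neg (Measure.measurePreserving_neg volume)

theorem continuous_reflectL2 : Continuous (reflectL2 d) :=
  (Lp.isometry_compMeasurePreserving (p := 2) (Measure.measurePreserving_neg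
    (volume : Measure (EuclideanSpace ℝ (Fin d))))).continuous

theorem coeFn_reflectL2 (f : L2Space d) : reflectL2 d f =ᵐ[volume] fun x => f (-x) :=
  Lp.coeFn_compMeasurePreserving f (Measure.measurePreserving_neg volume)

variable {d}

theorem L2Space.induction_schwartz {P : L2Space d → Prop} (hc : IsClosed {f | P f})
    (h : ∀ s : SchwartzMap (EuclideanSpace ℝ (Fin d)) ℂ, P (s.toLp 2)) (f : L2Space d) : P f :=
  DenseRange.induction_on
    (SchwartzMap.denseRange_toLpCLM (E := EuclideanSpace ℝ (Fin d)) (F := ℂ) (p := 2)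
      ENNReal.ofNat_ne_top) f hc h

theorem L2Space.eq_toLp_of_ae_eq {s : SchwartzMap (EuclideanSpace ℝ (Fin d)) ℂ} {f : L2Space d}
    (h : ⇑f =ᵐ[volume] ⇑s) : f = s.toLp 2 volume :=
  Lp.ext (h.trans (s.coeFn_toLp 2 volume).symm)

theorem conjL2_toLp (s : SchwartzMap (EuclideanSpace ℝ (Fin d)) ℂ) :
    conjL2 d (s.toLp 2) = (s.postcompCLM (Complex.conjCLE : ℂ →L[ℝ] ℂ)).toLp 2 := by
  refine L2Space.eq_toLp_of_ae_eq ?_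
  filter_upwards [coeFn_conjL2 d (s.toLp 2), s.coeFn_toLp 2 volume] with x h1 h2
  rw [h1, h2, SchwartzMap.postcompCLM_apply]
  simp

theorem reflectL2_toLp (s : SchwartzMap (EuclideanSpace ℝ (Fin d)) ℂ) :
    reflectL2 d (s.toLp 2) = (SchwartzMap.compCLMOfContinuousLinearEquiv ℂ
      (D := EuclideanSpace ℝ (Fin d)) (F := ℂ)
      (LinearIsometryEquiv.neg ℝ (E := EuclideanSpace ℝ (Fin d))) s).toLp 2 := by
  refine L2Space.eq_toLp_of_ae_eq ?_
  have h := (Measure.measurePreserving_neg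
    (volume : Measure (EuclideanSpace ℝ (Fin d)))).quasiMeasurePreserving.ae_eq_comp
    (s.coeFn_toLp 2 volume)
  filter_upwards [coeFn_reflectL2 d (s.toLp 2), h] with x h1 h2
  rw [h1]
  simpa using h2

theorem fourier_conjL2 (f : L2Space d) : 𝓕 (conjL2 d f) = conjL2 d (𝓕⁻ f : L2Space d) := by
  induction f using L2Space.induction_schwartz with
  | hc =>
    exact isClosed_eq ((continuous_fourierL2 d).comp (conjL2 d).continuous)
      ((conjL2 d).continuous.comp (continuous_fourierInvL2 d))
  | h s =>
    rw [conjL2_toLp, SchwartzMap.toLp_fourier_eq, SchwartzMap.toLp_fourierInv_eq, conjL2_toLp]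
    congr 1
    ext w
    rw [SchwartzMap.fourier_coe, SchwartzMap.postcompCLM_apply, SchwartzMap.fourierInv_coe,
      Real.fourier_eq', Real.fourierInv_eq']
    simp only [SchwartzMap.postcompCLM_apply, ContinuousLinearEquiv.coe_coe, Complex.conjCLE_apply]
    rw [← integral_conj]
    refine integral_congr_ae (Eventually.of_forall fun v => ?_)
    simp [← Complex.exp_conj, Complex.conj_ofNat]

theorem fourierInv_conjL2 (f : L2Space d) : 𝓕⁻ (conjL2 d f) = conjL2 d (𝓕 f : L2Space d) := by
  have h := fourier_conjL2 (𝓕 f : L2Space d)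
  rw [FourierTransform.fourierInv_fourier_eq] at h
  rw [← h, FourierTransform.fourierInv_fourier_eq]

theorem reflectL2_fourier (f : L2Space d) : reflectL2 d (𝓕 f) = 𝓕⁻ f := by
  induction f using L2Space.induction_schwartz with
  | hc =>
    exact isClosed_eq ((continuous_reflectL2 d).comp (continuous_fourierL2 d))
      (continuous_fourierInvL2 d)
  | h s =>
    rw [SchwartzMap.toLp_fourier_eq, SchwartzMap.toLp_fourierInv_eq, reflectL2_toLp,
      SchwartzMap.fourierInv_apply_eq]

theorem fourier_reflectL2 (f : L2Space d) : 𝓕 (reflectL2 d f) = 𝓕⁻ f := by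
  induction f using L2Space.induction_schwartz with
  | hc =>
    exact isClosed_eq ((continuous_fourierL2 d).comp (continuous_reflectL2 d))
      (continuous_fourierInvL2 d)
  | h s =>
    rw [reflectL2_toLp, SchwartzMap.toLp_fourier_eq, SchwartzMap.toLp_fourierInv_eq]
    congr 1
    ext w
    rw [SchwartzMap.fourier_coe, SchwartzMap.fourierInv_coe, Real.fourierInv_eq_fourier_comp_neg]
    rfl

theorem freeSymbol_neg (t : ℝ) (ξ : EuclideanSpace ℝ (Fin d)) :
    freeSymbol d (-t) ξ = starRingEnd ℂ (freeSymbol d t ξ) := by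
  simp [freeSymbol, ← Complex.exp_conj, Complex.conj_ofNat]

theorem mulFreeSymbol_neg_conjL2 (t : ℝ) (f : L2Space d) :
    mulFreeSymbol d (-t) (conjL2 d f) = conjL2 d (mulFreeSymbol d t f) := by
  refine Lp.ext ?_
  filter_upwards [coeFn_mulFreeSymbol d (-t) (conjL2 d f), coeFn_conjL2 d f,
    coeFn_conjL2 d (mulFreeSymbol d t f), coeFn_mulFreeSymbol d t f] with ξ h1 h2 h3 h4
  rw [h1, h2, h3, h4, freeSymbol_neg, map_mul]

theorem mulFreeSymbol_reflectL2 (t : ℝ) (f : L2Space d) :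
    mulFreeSymbol d t (reflectL2 d f) = reflectL2 d (mulFreeSymbol d t f) := by
  refine Lp.ext ?_
  have h := (Measure.measurePreserving_neg
    (volume : Measure (EuclideanSpace ℝ (Fin d)))).quasiMeasurePreserving.ae_eq_comp
    (coeFn_mulFreeSymbol d t f)
  filter_upwards [coeFn_mulFreeSymbol d t (reflectL2 d f), coeFn_reflectL2 d f,
    coeFn_reflectL2 d (mulFreeSymbol d t f), h] with ξ h1 h2 h3 h4
  rw [h1, h2, h3]
  simp only [Function.comp] at h4
  rw [h4]
  simp [freeSymbol]

/-- Time reversal: `e^{-itΔ/2} ψ̄` is the conjugate of `e^{itΔ/2} ψ`. -/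
theorem schrodinger_neg_conjL2 (t : ℝ) (ψ : L2Space d) :
    schrodinger d (-t) (conjL2 d ψ) = conjL2 d (schrodinger d t ψ) := by
  -- Conjugation exchanges `𝓕` and `𝓕⁻`, which leaves the conjugate of the multiplier taken between
  -- `𝓕⁻` and `𝓕`. Since the symbol is even, a reflection restores the usual order.
  rw [schrodinger_eq, schrodinger_eq, fourier_conjL2, mulFreeSymbol_neg_conjL2, fourierInv_conjL2,
    ← reflectL2_fourier, mulFreeSymbol_reflectL2, fourier_reflectL2]

end Schrodinger

/-! ### Comparison of the two constants -/

section Constants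

variable {d : ℕ}

theorem strichartzIntegral_eq_lintegral_prod {ψ : L2Space d} {U : ℝ × EuclideanSpace ℝ (Fin d) → ℂ}
    (hU : Measurable U) (h : ∀ t, (fun x => U (t, x)) =ᵐ[volume] schrodinger d t ψ) :
    strichartzIntegral d ψ = ∫⁻ z, ‖U z‖ₑ ^ (2 + 4 / (d : ℝ)) := by
  rw [Measure.volume_eq_prod, lintegral_prod _ (by fun_prop), strichartzIntegral]
  refine lintegral_congr fun t => lintegral_congr_ae ?_
  filter_upwards [h t] with x hx
  rw [hx]

theorem lintegral_schrodinger_neg (ψ : L2Space d) :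
    ∫⁻ t : ℝ, ∫⁻ x : EuclideanSpace ℝ (Fin d), ‖(schrodinger d (-t) ψ) x‖ₑ ^ (2 + 4 / (d : ℝ)) =
      strichartzIntegral d ψ :=
  (Measure.measurePreserving_neg (volume : Measure ℝ)).lintegral_comp_emb
    (MeasurableEquiv.neg ℝ).measurableEmbedding
    (fun t => ∫⁻ x : EuclideanSpace ℝ (Fin d), ‖(schrodinger d t ψ) x‖ₑ ^ (2 + 4 / (d : ℝ)))

theorem twoProfileIntegral_eq_lintegral_prod {ψp ψm : L2Space d}
    {U V : ℝ × EuclideanSpace ℝ (Fin d) → ℂ} (hU : Measurable U) (hV : Measurable V)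
    (hUψ : ∀ t, (fun x => U (t, x)) =ᵐ[volume] schrodinger d t ψp)
    (hVψ : ∀ t, (fun x => V (t, x)) =ᵐ[volume] schrodinger d (-t) ψm) (ℓ : ℝ) :
    twoProfileIntegral d ψp ψm ℓ = ∫⁻ z, ‖U z + timePhase ℓ z * V z‖ₑ ^ (2 + 4 / (d : ℝ)) := by
  rw [Measure.volume_eq_prod, lintegral_prod _ (by fun_prop), twoProfileIntegral]
  refine lintegral_congr fun t => lintegral_congr_ae ?_
  filter_upwards [hUψ t, hVψ t] with x h1 h2
  rw [h1, h2, timePhase]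

/-- Jointly measurable versions of the two profiles, and the limit of `twoProfileIntegral`. -/
theorem exists_profiles (ψp ψm : L2Space d) :
    ∃ U V : ℝ × EuclideanSpace ℝ (Fin d) → ℂ, Measurable U ∧ Measurable V ∧
      (∀ t, (fun x => U (t, x)) =ᵐ[volume] schrodinger d t ψp) ∧
      (∀ t, (fun x => V (t, x)) =ᵐ[volume] schrodinger d (-t) ψm) ∧
      Tendsto (twoProfileIntegral d ψp ψm) atTop
        (𝓝 (∫⁻ z, phaseMean (2 + 4 / (d : ℝ)) (U z) (V z))) := by
  obtain ⟨U, hU, hUψ⟩ := exists_measurable_schrodinger d ψp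
  obtain ⟨V, hV, hVψ⟩ := exists_measurable_schrodinger d ψm
  have hV' : Measurable fun z : ℝ × EuclideanSpace ℝ (Fin d) => V (-z.1, z.2) := by fun_prop
  have hq : 1 ≤ 2 + 4 / (d : ℝ) := by
    have : 0 ≤ 4 / (d : ℝ) := by positivity
    linarith
  refine ⟨U, fun z => V (-z.1, z.2), hU, hV', hUψ, fun t => hVψ (-t), ?_⟩
  have : (volume : Measure (ℝ × EuclideanSpace ℝ (Fin d))).IsAddHaarMeasure := by
    rw [Measure.volume_eq_prod]; infer_instance
  exact (tendsto_lintegral_modulated hq hU hV').congr fun ℓ =>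
    (twoProfileIntegral_eq_lintegral_prod hU hV' hUψ (fun t => hVψ (-t)) ℓ).symm

theorem strichartzIntegral_zero : strichartzIntegral d 0 = 0 := by
  have hq : 0 < 2 + 4 / (d : ℝ) := by positivity
  have h0 : ∀ t, schrodinger d t (0 : L2Space d) = 0 := fun t => by
    have h : mulFreeSymbol d t (𝓕 (0 : L2Space d)) = 0 := by
      refine Lp.ext ?_
      rw [FourierTransform.fourier_zero]
      filter_upwards [coeFn_mulFreeSymbol d t 0, Lp.coeFn_zero ℂ 2
        (volume : Measure (EuclideanSpace ℝ (Fin d)))] with ξ h1 h2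
      rw [h1, h2]; simp
    rw [schrodinger_eq, h, FourierTransform.fourierInv_zero]
  rw [strichartzIntegral]
  refine (lintegral_congr fun t => ?_).trans lintegral_zero
  rw [h0]
  refine (lintegral_congr_ae ?_).trans lintegral_zero
  filter_upwards [Lp.coeFn_zero ℂ 2 (volume : Measure (EuclideanSpace ℝ (Fin d)))] with x hx
  rw [hx, Pi.zero_apply, enorm_zero, ENNReal.zero_rpow_of_pos hq]

theorem strichartzIntegral_le (ψ : L2Space d) :
    strichartzIntegral d ψ ≤ (⨆ (φ : L2Space d) (_ : φ ≠ 0),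
      strichartzIntegral d φ / ‖φ‖ₑ ^ (2 + 4 / (d : ℝ))) * ‖ψ‖ₑ ^ (2 + 4 / (d : ℝ)) := by
  have hq : 0 < 2 + 4 / (d : ℝ) := by positivity
  by_cases h : ψ = 0
  · simp [h, strichartzIntegral_zero]
  · have h0 : ‖ψ‖ₑ ^ (2 + 4 / (d : ℝ)) ≠ 0 := by
      rw [Ne, ENNReal.rpow_eq_zero_iff_of_pos hq, enorm_eq_zero]; exact h
    have ht : ‖ψ‖ₑ ^ (2 + 4 / (d : ℝ)) ≠ ∞ := ENNReal.rpow_ne_top_of_nonneg hq.le enorm_ne_top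
    rw [← ENNReal.div_le_iff h0 ht]
    exact le_iSup₂_of_le ψ h le_rfl

/-- Minkowski's inequality in L^{q/2}, available because q ≥ 2, for the squared moduli. -/
theorem lintegral_add_sq_rpow_le {X : Type*} [MeasurableSpace X] {ν : Measure X} {q : ℝ}
    (hq : 2 ≤ q) {U V : X → ℂ} (hU : Measurable U) (hV : Measurable V) {K a b : ℝ≥0∞}
    (ha : ∫⁻ z, ‖U z‖ₑ ^ q ∂ν ≤ K * a ^ q) (hb : ∫⁻ z, ‖V z‖ₑ ^ q ∂ν ≤ K * b ^ q) :
    ∫⁻ z, (‖U z‖ₑ ^ 2 + ‖V z‖ₑ ^ 2) ^ (q / 2) ∂ν ≤ K * (a ^ 2 + b ^ 2) ^ (q / 2) := by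
  have hp : 1 ≤ q / 2 := by linarith
  have hp0 : 0 < q / 2 := by linarith
  have hsq : ∀ x : ℝ≥0∞, (x ^ 2) ^ (q / 2) = x ^ q := fun x => by
    rw [← ENNReal.rpow_natCast_mul]; congr 1; push_cast; ring
  have hroot : ∀ (W : X → ℂ) (c : ℝ≥0∞), ∫⁻ z, ‖W z‖ₑ ^ q ∂ν ≤ K * c ^ q →
      (∫⁻ z, (‖W z‖ₑ ^ 2) ^ (q / 2) ∂ν) ^ (1 / (q / 2)) ≤ K ^ (1 / (q / 2)) * c ^ 2 := by
    intro W c h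
    simp_rw [hsq]
    refine (ENNReal.rpow_le_rpow h (by positivity)).trans (le_of_eq ?_)
    rw [ENNReal.mul_rpow_of_nonneg _ _ (by positivity), ← hsq c, ← ENNReal.rpow_mul (c ^ 2),
      mul_one_div_cancel hp0.ne', ENNReal.rpow_one]
  have h := (ENNReal.lintegral_Lp_add_le (μ := ν) (hU.enorm.pow_const 2).aemeasurable
    (hV.enorm.pow_const 2).aemeasurable hp).trans (add_le_add (hroot U a ha) (hroot V b hb))
  rw [← mul_add, one_div, ENNReal.rpow_inv_le_iff hp0, ENNReal.mul_rpow_of_nonneg _ _ hp0.le,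
    ENNReal.rpow_inv_rpow hp0.ne'] at h
  exact h

theorem limUnder_twoProfileIntegral_le (ψp ψm : L2Space d) :
    limUnder atTop (twoProfileIntegral d ψp ψm) ≤
      phaseMean (2 + 4 / (d : ℝ)) 1 1 * 2⁻¹ ^ (1 + 2 / (d : ℝ)) *
        (⨆ (φ : L2Space d) (_ : φ ≠ 0), strichartzIntegral d φ / ‖φ‖ₑ ^ (2 + 4 / (d : ℝ))) *
        (‖ψp‖ₑ ^ 2 + ‖ψm‖ₑ ^ 2) ^ (1 + 2 / (d : ℝ)) := by
  obtain ⟨U, V, hU, hV, hUψ, hVψ, hlim⟩ := exists_profiles ψp ψm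
  rw [hlim.limUnder_eq]
  have hq : 2 ≤ 2 + 4 / (d : ℝ) := by
    have : 0 ≤ 4 / (d : ℝ) := by positivity
    linarith
  have hq2 : (2 + 4 / (d : ℝ)) / 2 = 1 + 2 / (d : ℝ) := by ring
  set K := ⨆ (φ : L2Space d) (_ : φ ≠ 0), strichartzIntegral d φ / ‖φ‖ₑ ^ (2 + 4 / (d : ℝ)) with hK
  have hUK : ∫⁻ z, ‖U z‖ₑ ^ (2 + 4 / (d : ℝ)) ≤ K * ‖ψp‖ₑ ^ (2 + 4 / (d : ℝ)) := by
    rw [← strichartzIntegral_eq_lintegral_prod hU hUψ]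
    exact strichartzIntegral_le ψp
  have hVK : ∫⁻ z, ‖V z‖ₑ ^ (2 + 4 / (d : ℝ)) ≤ K * ‖ψm‖ₑ ^ (2 + 4 / (d : ℝ)) := by
    refine le_trans (le_of_eq ?_) (strichartzIntegral_le ψm)
    rw [← lintegral_schrodinger_neg, Measure.volume_eq_prod, lintegral_prod _ (by fun_prop)]
    refine lintegral_congr fun t => lintegral_congr_ae ?_
    filter_upwards [hVψ t] with x hx
    rw [hx]
  have hM := lintegral_add_sq_rpow_le hq hU hV hUK hVK
  rw [hq2] at hM
  have hp0 : 0 ≤ 1 + 2 / (d : ℝ) := by positivity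
  calc ∫⁻ z, phaseMean (2 + 4 / (d : ℝ)) (U z) (V z)
      ≤ ∫⁻ z, phaseMean (2 + 4 / (d : ℝ)) 1 1 * 2⁻¹ ^ (1 + 2 / (d : ℝ)) *
          (‖U z‖ₑ ^ 2 + ‖V z‖ₑ ^ 2) ^ (1 + 2 / (d : ℝ)) := by
        refine lintegral_mono fun z => (phaseMean_le hq _ _).trans (le_of_eq ?_)
        rw [hq2, div_eq_mul_inv (_ + _) (2 : ℝ≥0∞), ENNReal.mul_rpow_of_nonneg _ _ hp0, mul_assoc]
        congr 1
        rw [mul_comm]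
    _ = phaseMean (2 + 4 / (d : ℝ)) 1 1 * 2⁻¹ ^ (1 + 2 / (d : ℝ)) *
          ∫⁻ z, (‖U z‖ₑ ^ 2 + ‖V z‖ₑ ^ 2) ^ (1 + 2 / (d : ℝ)) :=
        lintegral_const_mul _ (by fun_prop)
    _ ≤ _ := by
        rw [mul_assoc _ K]
        gcongr

/-- By time reversal the two profiles have equal modulus almost everywhere, which is the equality
case of the pointwise bound. -/
theorem limUnder_twoProfileIntegral_conj (ψ : L2Space d) :
    limUnder atTop (twoProfileIntegral d ψ (conjL2 d ψ)) =
      phaseMean (2 + 4 / (d : ℝ)) 1 1 * strichartzIntegral d ψ := by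
  obtain ⟨U, V, hU, hV, hUψ, hVψ, hlim⟩ := exists_profiles ψ (conjL2 d ψ)
  have hq : 0 ≤ 2 + 4 / (d : ℝ) := by positivity
  rw [hlim.limUnder_eq, strichartzIntegral_eq_lintegral_prod hU hUψ,
    ← lintegral_const_mul _ (by fun_prop), Measure.volume_eq_prod,
    lintegral_prod _ (measurable_phaseMean_comp _ hU hV).aemeasurable,
    lintegral_prod _ (by fun_prop)]
  refine lintegral_congr fun t => lintegral_congr_ae ?_
  filter_upwards [hUψ t, hVψ t, coeFn_conjL2 d (schrodinger d t ψ)] with x h1 h2 h3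
  rw [mul_comm]
  refine phaseMean_of_norm_eq _ hq ?_
  rw [h1, h2, schrodinger_neg_conjL2, h3, RCLike.norm_conj]

theorem iSup_twoProfile_eq :
    (⨆ (ψp : L2Space d) (ψm : L2Space d) (_ : (ψp, ψm) ≠ (0, 0)),
      limUnder atTop (twoProfileIntegral d ψp ψm) /
        (‖ψp‖ₑ ^ 2 + ‖ψm‖ₑ ^ 2) ^ (1 + 2 / (d : ℝ))) =
      phaseMean (2 + 4 / (d : ℝ)) 1 1 * 2⁻¹ ^ (1 + 2 / (d : ℝ)) *
        ⨆ (φ : L2Space d) (_ : φ ≠ 0), strichartzIntegral d φ / ‖φ‖ₑ ^ (2 + 4 / (d : ℝ)) := by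
  have hp0 : 0 ≤ 1 + 2 / (d : ℝ) := by positivity
  apply le_antisymm
  · refine iSup_le fun ψp => iSup_le fun ψm => iSup_le fun _ => ?_
    exact ENNReal.div_le_of_le_mul (limUnder_twoProfileIntegral_le ψp ψm)
  · simp_rw [ENNReal.mul_iSup]
    refine iSup₂_le fun ψ hψ => ?_
    -- The trial pair consists of ψ and its conjugate; its total squared mass 2‖ψ‖² produces the
    -- factor 2^{-q/2}.
    refine le_iSup_of_le ψ (le_iSup_of_le (conjL2 d ψ)
      (le_iSup_of_le (fun h => hψ (Prod.mk.inj h).1) (le_of_eq ?_)))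
    have hsq : (‖ψ‖ₑ ^ 2) ^ (1 + 2 / (d : ℝ)) = ‖ψ‖ₑ ^ (2 + 4 / (d : ℝ)) := by
      rw [← ENNReal.rpow_natCast_mul]; congr 1; push_cast; ring
    rw [limUnder_twoProfileIntegral_conj, enorm_conjL2, ← two_mul,
      ENNReal.mul_rpow_of_nonneg _ _ hp0, hsq, ENNReal.inv_rpow]
    simp only [div_eq_mul_inv]
    rw [ENNReal.mul_inv (Or.inl (by simp)) (Or.inl (by simp))]
    ring

end Constants

theorem mainTheorem7 (d : ℕ) (hd : 1 ≤ d) (q : ℝ) (hq : q = 2 + 4 / (d : ℝ)) :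
    (∀ ψp ψm : L2Space d, ∃ L : ℝ≥0∞,
      Tendsto (twoProfileIntegral d ψp ψm) atTop (𝓝 L)) ∧
    twoProfileConst d =
      ENNReal.ofReal (2 ^ (q / 2) / √Real.pi *
        (Real.Gamma ((q + 1) / 2) / Real.Gamma ((q + 2) / 2))) * strichartzConst d := by
  refine ⟨fun ψp ψm => ?_, ?_⟩
  · obtain ⟨U, V, -, -, -, -, hlim⟩ := exists_profiles ψp ψm
    exact ⟨_, hlim⟩
  · have hq0 : 0 < q := by rw [hq]; positivity
    have hq2 : 1 + 2 / (d : ℝ) = q / 2 := by rw [hq]; ring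
    have hC : phaseMean q 1 1 * 2⁻¹ ^ (q / 2) =
        ENNReal.ofReal (2 ^ (q / 2) / √Real.pi *
          (Real.Gamma ((q + 1) / 2) / Real.Gamma ((q + 2) / 2))) := by
      rw [phaseMean_one_one hq0, show (2⁻¹ : ℝ≥0∞) = ENNReal.ofReal 2⁻¹ by
          rw [ENNReal.ofReal_inv_of_pos two_pos]; simp,
        ENNReal.ofReal_rpow_of_pos (by norm_num), ← ENNReal.ofReal_mul' (by positivity)]
      congr 1
      have h2 : (2 : ℝ) ^ q = 2 ^ (q / 2) * 2 ^ (q / 2) := by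
        rw [← Real.rpow_add two_pos]; congr 1; ring
      rw [Real.inv_rpow zero_le_two, h2]
      field_simp
    rw [twoProfileConst, strichartzConst, iSup_twoProfile_eq, hq2, ← hq, hC, mul_left_comm]
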